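/- Let $\mathbb{K}$ be a field of characteristic zero, $l\ge 0$ an integer, $S=\mathbb{K}[x_1,\dots,x_l]$ with its standard grading, and let $\mathcal{A}$ be a central hyperplane arrangement in $\mathbb{K}^l$, i.e. a finite set of hyperplanes through the origin. For each $H\in\mathcal{A}$ let $\alpha_H\in S$ be a linear form with zero set $H$, let $\mathrm{Der}=\bigoplus_{i=1}^l S\,\partial_{x_i}$ be the module of polynomial vector fields on $\mathbb{K}^l$, where $\sum_i f_i\partial_{x_i}$ is homogeneous of degree $d$ if every $f_i$ is a homogeneous polynomial of degree $d$, and let $$D(\mathcal{A})=\{\delta\in\mathrm{Der} : \delta(\alpha_H)\in \alpha_H S \text{ for all } H\in\mathcal{A}\}$$ be the graded $S$-module of logarithmic vector fields. The arrangement $\mathcal{A}$ is called free if $D(\mathcal{A})$ has an $S$-basis of $l$ homogeneous vector fields, and plus-one generated if, for some integers $d,d_1,\dots,d_l\ge 0$, $D(\mathcal{A})$ has a minimal graded free resolution of the form $$0\to S(-d-1)\to S(-d)\oplus\bigoplus_{i=1}^l S(-d_i)\to D(\mathcal{A})\to 0 .$$ Let $X$ be a flat of $\mathcal{A}$, i.e.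 an intersection of some (possibly no) hyperplanes of $\mathcal{A}$, and let $\mathcal{A}_X=\{H\in\mathcal{A} : X\subseteq H\}$. If $\mathcal{A}$ is plus-one generated, then $\mathcal{A}_X$ is free or $D(\mathcal{A}_X)$ has a minimal graded free resolution of the form $$0\to S\to S^{l+1}\to D(\mathcal{A}_X)\to 0$$ (with suitable degree shifts in $S$ and $S^{l+1}$). In particular, in both cases $D(\mathcal{A}_X)$ is generated as an $S$-module by $l+1$ (not necessarily distinct or nonzero) vector fields. -/

import Mathlib

namespace HypArr

open MvPolynomial

/-- The coordinate ring `S = K[x_1, …, x_l]` of `K^l`. -/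
abbrev CoordRing (K : Type*) [Field K] (l : ℕ) : Type _ := MvPolynomial (Fin l) K

/-- The `S`-module `Der` of polynomial vector fields on `K^l`; the coefficients of `δ` in the basis
of partial derivatives are the polynomials `δ (X j)`. -/
abbrev VectorField (K : Type*) [Field K] (l : ℕ) : Type _ :=
  Derivation K (CoordRing K l) (CoordRing K l)

/-- A linear form on `K^l`, seen as a homogeneous linear polynomial. -/
noncomputable def linPoly {K : Type*} [Field K] {l : ℕ} (a : Module.Dual K (Fin l → K)) :
    CoordRing K l :=
  ∑ j, C (a (Pi.single j 1)) * X j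

/-- A central hyperplane arrangement in `K^l`: a finite set of hyperplanes through the origin. -/
structure Arrangement (K : Type*) [Field K] (l : ℕ) where
  hyperplanes : Set (Submodule K (Fin l → K))
  finite : hyperplanes.Finite
  isHyperplane : ∀ H ∈ hyperplanes, ∃ a : Module.Dual K (Fin l → K), a ≠ 0 ∧ LinearMap.ker a = H

variable {K : Type*} [Field K] {l : ℕ}

/-- `L(A)`: all intersections of subsets of `A` (the empty intersection is the whole space). -/
def Arrangement.lattice (A : Arrangement K l) : Set (Submodule K (Fin l → K)) :=
  {X | ∃ B ⊆ A.hyperplanes, X = sInf B}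

/-- The localization `A_X`: the hyperplanes of `A` containing `X`. -/
def Arrangement.localization (A : Arrangement K l) (X : Submodule K (Fin l → K)) :
    Arrangement K l where
  hyperplanes := {H ∈ A.hyperplanes | X ≤ H}
  finite := A.finite.subset fun _ hH => hH.1
  isHyperplane := fun H hH => A.isHyperplane H hH.1

/-- The module `D(A)` of logarithmic vector fields: those `δ` such that `δ(α) ∈ αS` for every
hyperplane `H ∈ A` and every (equivalently, any one) linear form `α` defining `H`. -/
def Arrangement.logDer (A : Arrangement K l) :
    Submodule (CoordRing K l) (VectorField K l) where
  carrier := {δ | ∀ H ∈ A.hyperplanes, ∀ a : Module.Dual K (Fin l → K), LinearMap.ker a = H →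
    δ (linPoly a) ∈ Ideal.span {linPoly a}}
  zero_mem' := fun _ _ _ _ => by simp
  add_mem' := fun {_ _} h₁ h₂ H hH a ha => by
    simpa using Ideal.add_mem _ (h₁ H hH a ha) (h₂ H hH a ha)
  smul_mem' := fun p _ h H hH a ha => by
    simpa using Ideal.mul_mem_left _ p (h H hH a ha)

/-- `δ` is homogeneous of polynomial degree `d`. -/
def IsHomogeneousVF (δ : VectorField K l) (d : ℕ) : Prop :=
  ∀ j : Fin l, (δ (X j)).IsHomogeneous d

/-- `A` is free with exponents `e`: `D(A)` has a basis of `l` homogeneous vector fields,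
of polynomial degrees `e 1, …, e l`. -/
def Arrangement.IsFreeWithExponents (A : Arrangement K l) (e : Fin l → ℕ) : Prop :=
  ∃ b : Module.Basis (Fin l) (CoordRing K l) A.logDer,
    ∀ i, IsHomogeneousVF (b i : VectorField K l) (e i)

/-- `A` is free (with some exponents). -/
def Arrangement.IsFree (A : Arrangement K l) : Prop :=
  ∃ e : Fin l → ℕ, A.IsFreeWithExponents e

/-- `v` is a homogeneous element of degree `n` of the graded free module `⨁ᵢ S(-eᵢ)`: its `i`-th
coordinate is a form of degree `n - eᵢ` (so it is `0` when `n < eᵢ`). -/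
def IsHomogeneousShifted {ι : Type*} (e : ι → ℕ) (n : ℕ) (v : ι → CoordRing K l) : Prop :=
  ∀ i, v i = 0 ∨ ∃ k, k + e i = n ∧ (v i).IsHomogeneous k

/-- `0 → ⨁ₖ S(-bₖ) --φ--> ⨁ᵢ S(-eᵢ) --ε--> M → 0` is a minimal graded free resolution of the
submodule `M` of `Der`: both maps preserve degrees, the sequence is exact, and the image of `φ`
lies in `𝔪 · ⨁ᵢ S(-eᵢ)`, where `𝔪` is the ideal of polynomials with zero constant term.
Nonnegative shifts are no restriction, since `M` lives in degrees `≥ 0` and, by minimality, no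
free generator is superfluous. -/
structure IsMinimalResolution {κ ι : Type*} (M : Submodule (CoordRing K l) (VectorField K l))
    (b : κ → ℕ) (e : ι → ℕ)
    (φ : (κ → CoordRing K l) →ₗ[CoordRing K l] (ι → CoordRing K l))
    (ε : (ι → CoordRing K l) →ₗ[CoordRing K l] M) : Prop where
  graded_left : ∀ n v, IsHomogeneousShifted b n v → IsHomogeneousShifted e n (φ v)
  graded_right : ∀ n v, IsHomogeneousShifted e n v → IsHomogeneousVF (ε v : VectorField K l) n
  injective : Function.Injective φ
  exact : Function.Exact φ ε
  surjective : Function.Surjective ε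
  minimal : ∀ v i, constantCoeff (φ v i) = 0

/-- `A` is plus-one generated with exponents `d 1, …, d l` and level `d₀`: `D(A)` has a minimal
graded free resolution `0 → S(-d₀-1) → S(-d₀) ⊕ ⨁ᵢ S(-dᵢ) → D(A) → 0`. -/
def Arrangement.IsPlusOneGeneratedWith (A : Arrangement K l) (d : Fin l → ℕ) (d₀ : ℕ) : Prop :=
  ∃ φ ε, IsMinimalResolution A.logDer (fun _ : Fin 1 => d₀ + 1)
    (Fin.cons d₀ d : Fin (l + 1) → ℕ) φ ε

/-- `A` is plus-one generated (with some exponents and level). -/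
def Arrangement.IsPlusOneGenerated (A : Arrangement K l) : Prop :=
  ∃ d d₀, A.IsPlusOneGeneratedWith d d₀

end HypArr

/-! Near a generic point `p` of `X`, the arrangement looks like `A_X`: the hyperplanes of `A`
through `p` are exactly those containing `X`, and the product `f` of the other forms is nonzero at
`p`. Hence `f • D(A_X) ⊆ D(A) ⊆ D(A_X)`. Since `A_X` is invariant under translation by `p`, moving
`p` to the origin shows that the `l + 1` generators of `D(A)` yield `l + 1` elements generating
`D(A_X)` up to a factor with nonzero constant term (`Arrangement.exists_localization_generators`).

Because `D(A_X)` is graded, this local bound is global: `M/𝔪M` has dimension at most `l + 1` for `M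
= D(A_X)`, and graded Nakayama lifts a homogeneous basis of it to minimal generators
(`exists_minimal_generators`).

The rank of `D(A_X)` is `l`. With at most `l` generators there are no relations, and `A_X` is free.
With `l + 1` the relation module has rank one and is saturated, as `Der` is torsion-free; over the
factorial ring `S` it is therefore cyclic, and its generator can be taken homogeneous
(`exists_isMinimalResolution`). -/

namespace HypArr

open MvPolynomial

/-! ### Homogeneous components and coefficientwise maps of vector fields -/

section Coefficientwise

variable {K : Type*} [Field K] {l : ℕ}

theorem homogeneousComponent_mul_of_isHomogeneous {σ R : Type*} [CommRing R]
    (p : MvPolynomial σ R) {q : MvPolynomial σ R} {e : ℕ} (hq : q.IsHomogeneous e) (d : ℕ) :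
    homogeneousComponent d (p * q) = if e ≤ d then homogeneousComponent (d - e) p * q else 0 := by
  have hi (i : ℕ) : homogeneousComponent d (homogeneousComponent i p * q) =
      if d = i + e then homogeneousComponent i p * q else 0 :=
    homogeneousComponent_of_mem ((homogeneousComponent_isHomogeneous i p).mul hq)
  conv_lhs => rw [← sum_homogeneousComponent p, Finset.sum_mul, map_sum]
  simp_rw [hi]
  split_ifs with h
  · have h' (i : ℕ) : d = i + e ↔ i = d - e := by omega
    simp_rw [h', Finset.sum_ite_eq', Finset.mem_range]
    split_ifs with hlt
    · rfl
    · rw [homogeneousComponent_eq_zero _ _ (by omega), zero_mul]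
  · exact Finset.sum_eq_zero fun i _ => if_neg (by omega)

theorem sum_homogeneousComponent_of_totalDegree_lt {σ R : Type*} [CommRing R]
    (p : MvPolynomial σ R) {N : ℕ} (hN : p.totalDegree < N) :
    ∑ i ∈ Finset.range N, homogeneousComponent i p = p := by
  conv_rhs => rw [← sum_homogeneousComponent p]
  symm
  refine Finset.sum_subset (Finset.range_subset_range.2 hN) fun i _ hi => ?_
  exact homogeneousComponent_eq_zero _ _ (by simpa using hi)

theorem derivation_sum_apply {ι : Type*} (s : Finset ι) (δ : ι → VectorField K l)
    (p : CoordRing K l) : (∑ i ∈ s, δ i) p = ∑ i ∈ s, δ i p := by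
  classical
  induction s using Finset.induction_on with
  | empty => simp
  | insert i s hi ih => rw [Finset.sum_insert hi, Finset.sum_insert hi, Derivation.add_apply, ih]

/-- Apply a `K`-linear map to the coefficients of a vector field. -/
noncomputable def mapVF (L : CoordRing K l →ₗ[K] CoordRing K l) :
    VectorField K l →ₗ[K] VectorField K l where
  toFun δ := mkDerivation K fun j => L (δ (X j))
  map_add' δ₁ δ₂ := derivation_ext fun j => by simp
  map_smul' c δ := derivation_ext fun j => by simp

@[simp]
theorem mapVF_X (L : CoordRing K l →ₗ[K] CoordRing K l) (δ : VectorField K l) (j : Fin l) :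
    mapVF L δ (X j) = L (δ (X j)) := by
  simp [mapVF]

theorem apply_linPoly (δ : VectorField K l) (a : Module.Dual K (Fin l → K)) :
    δ (linPoly a) = ∑ j, a (Pi.single j 1) • δ (X j) := by
  simp only [linPoly, map_sum, ← smul_eq_C_mul, Derivation.map_smul]

/-- The value of `δ` on a linear form is a `K`-linear combination of its coefficients, so any
`K`-linear `L` passes through. This serves both homogeneous components and translations. -/
theorem mapVF_linPoly (L : CoordRing K l →ₗ[K] CoordRing K l) (δ : VectorField K l)
    (a : Module.Dual K (Fin l → K)) : mapVF L δ (linPoly a) = L (δ (linPoly a)) := by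
  simp only [apply_linPoly, mapVF_X, map_sum, map_smul]

/-- The homogeneous component of degree `d` of a vector field. -/
noncomputable def componentVF (d : ℕ) : VectorField K l →ₗ[K] VectorField K l :=
  mapVF (homogeneousComponent d)

@[simp]
theorem componentVF_X (d : ℕ) (δ : VectorField K l) (j : Fin l) :
    componentVF d δ (X j) = homogeneousComponent d (δ (X j)) :=
  mapVF_X _ _ _

theorem isHomogeneousVF_componentVF (d : ℕ) (δ : VectorField K l) :
    IsHomogeneousVF (componentVF d δ) d := fun j => by
  rw [componentVF_X]
  exact homogeneousComponent_isHomogeneous _ _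

theorem IsHomogeneousVF.smul {δ : VectorField K l} {d k : ℕ} (h : IsHomogeneousVF δ d)
    {p : CoordRing K l} (hp : p.IsHomogeneous k) : IsHomogeneousVF (p • δ) (k + d) := fun j => by
  simpa using hp.mul (h j)

theorem IsHomogeneousVF.sum {ι : Type*} {s : Finset ι} {δ : ι → VectorField K l} {d : ℕ}
    (h : ∀ i ∈ s, IsHomogeneousVF (δ i) d) : IsHomogeneousVF (∑ i ∈ s, δ i) d := fun j => by
  rw [derivation_sum_apply]
  exact IsHomogeneous.sum _ _ _ fun i hi => h i hi j

theorem componentVF_smul {δ : VectorField K l} {e : ℕ} (h : IsHomogeneousVF δ e)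
    (p : CoordRing K l) (d : ℕ) :
    componentVF d (p • δ) = if e ≤ d then homogeneousComponent (d - e) p • δ else 0 :=
  derivation_ext fun j => by
    rw [componentVF_X, Derivation.smul_apply, smul_eq_mul,
      homogeneousComponent_mul_of_isHomogeneous _ (h j)]
    split_ifs <;> simp

theorem exists_sum_componentVF (δ : VectorField K l) :
    ∃ N, ∑ d ∈ Finset.range N, componentVF d δ = δ := by
  refine ⟨(Finset.univ.sup fun j => (δ (X j)).totalDegree) + 1, derivation_ext fun j => ?_⟩
  rw [derivation_sum_apply]
  simp only [componentVF_X]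
  exact sum_homogeneousComponent_of_totalDegree_lt _
    (Nat.lt_succ_of_le (Finset.le_sup (f := fun j => (δ (X j)).totalDegree) (Finset.mem_univ j)))

/-- A submodule of `Der` is graded if it contains the components of its elements. -/
def IsGradedSubmodule (M : Submodule (CoordRing K l) (VectorField K l)) : Prop :=
  ∀ δ ∈ M, ∀ d, componentVF d δ ∈ M

theorem isGradedSubmodule_span {ι : Type*} {η : ι → VectorField K l} {e : ι → ℕ}
    (h : ∀ i, IsHomogeneousVF (η i) (e i)) :
    IsGradedSubmodule (Submodule.span (CoordRing K l) (Set.range η)) := by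
  intro δ hδ d
  induction hδ using Submodule.span_induction generalizing d with
  | mem x hx =>
    obtain ⟨i, rfl⟩ := hx
    have := componentVF_smul (h i) 1 d
    rw [one_smul] at this
    rw [this]
    split_ifs
    · exact Submodule.smul_mem _ _ (Submodule.subset_span ⟨i, rfl⟩)
    · exact zero_mem _
  | zero => simp
  | add x y _ _ hx hy => rw [map_add]; exact add_mem (hx d) (hy d)
  | smul a x _ hx =>
    obtain ⟨N, hN⟩ := exists_sum_componentVF x
    rw [← hN, Finset.smul_sum, map_sum]
    refine sum_mem fun j _ => ?_
    rw [componentVF_smul (isHomogeneousVF_componentVF j x)]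
    split_ifs
    · exact Submodule.smul_mem _ _ (hx j)
    · exact zero_mem _

/-- The ideal of polynomials without constant term. -/
noncomputable def irrelevantIdeal (K : Type*) [Field K] (l : ℕ) : Ideal (CoordRing K l) :=
  RingHom.ker constantCoeff

/-- Graded Nakayama lemma. -/
theorem le_of_le_sup_irrelevantIdeal_smul {M N : Submodule (CoordRing K l) (VectorField K l)}
    (hN : IsGradedSubmodule N)
    (h : M ≤ N ⊔ irrelevantIdeal K l • M) : M ≤ N := by
  -- Strong induction on the degree, over all of `M` at once; `M` itself need not be graded.
  have key (d : ℕ) : ∀ δ ∈ M, componentVF d δ ∈ N := by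
    induction d using Nat.strong_induction_on with
    | _ d ih =>
    intro δ hδ
    obtain ⟨n, hn, r, hr, rfl⟩ := Submodule.mem_sup.1 (h hδ)
    rw [map_add]
    refine add_mem (hN n hn d) ?_
    clear hδ
    induction hr using Submodule.smul_induction_on' with
    | smul a ha x hx =>
      obtain ⟨k, hk⟩ := exists_sum_componentVF x
      rw [← hk, Finset.smul_sum, map_sum]
      refine sum_mem fun j _ => ?_
      rw [componentVF_smul (isHomogeneousVF_componentVF j x)]
      split_ifs with hjd
      · rcases hjd.lt_or_eq with hlt | rfl
        · exact Submodule.smul_mem _ _ (ih j hlt x hx)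
        · have : coeff 0 a = 0 := ha
          simp [this]
      · exact zero_mem _
    | add x _ y _ hx hy => rw [map_add]; exact add_mem hx hy
  intro δ hδ
  obtain ⟨k, hk⟩ := exists_sum_componentVF δ
  rw [← hk]
  exact sum_mem fun j _ => key j δ hδ

end Coefficientwise

/-! ### Logarithmic vector fields -/

section Logarithmic

variable {K : Type*} [Field K] {l : ℕ}

theorem isHomogeneous_linPoly (a : Module.Dual K (Fin l → K)) :
    (linPoly a).IsHomogeneous 1 := by
  refine IsHomogeneous.sum _ _ _ fun j _ => ?_
  simpa using (isHomogeneous_C (Fin l) (a (Pi.single j 1))).mul (isHomogeneous_X K j)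

theorem eval_linPoly (a : Module.Dual K (Fin l → K)) (p : Fin l → K) :
    eval p (linPoly a) = a p := by
  rw [a.pi_apply_eq_sum_univ p]
  have (j : Fin l) : (Pi.single j 1 : Fin l → K) = fun i => if j = i then 1 else 0 := by
    ext i
    simp [Pi.single_apply, eq_comm]
  simp [linPoly, map_sum, mul_comm, this]

theorem linPoly_smul (c : K) (a : Module.Dual K (Fin l → K)) :
    linPoly (c • a) = C c * linPoly a := by
  simp [linPoly, Finset.mul_sum, mul_assoc]

theorem linPoly_ne_zero {a : Module.Dual K (Fin l → K)} (ha : a ≠ 0) : linPoly a ≠ 0 := by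
  intro h
  refine ha (LinearMap.ext fun p => ?_)
  rw [← eval_linPoly, h, map_zero, LinearMap.zero_apply]

theorem linPoly_dvd_of_ker_le {a b : Module.Dual K (Fin l → K)}
    (h : LinearMap.ker a ≤ LinearMap.ker b) : linPoly a ∣ linPoly b := by
  have hb : b ∈ Submodule.span K (Set.range fun _ : Unit => a) :=
    mem_span_of_iInf_ker_le_ker (by simpa using h)
  rw [Set.range_const, Submodule.mem_span_singleton] at hb
  obtain ⟨c, rfl⟩ := hb
  exact ⟨C c, by rw [linPoly_smul, mul_comm]⟩

theorem Arrangement.mem_logDer {A : Arrangement K l} {δ : VectorField K l} :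
    δ ∈ A.logDer ↔ ∀ H ∈ A.hyperplanes, ∀ a : Module.Dual K (Fin l → K),
      LinearMap.ker a = H → linPoly a ∣ δ (linPoly a) := by
  simp only [← Ideal.mem_span_singleton]
  rfl

theorem Arrangement.isGradedSubmodule_logDer (A : Arrangement K l) :
    IsGradedSubmodule A.logDer := by
  intro δ hδ d
  rw [Arrangement.mem_logDer] at hδ ⊢
  intro H hH a ha
  obtain ⟨q, hq⟩ := hδ H hH a ha
  rw [componentVF, mapVF_linPoly, hq, mul_comm,
    homogeneousComponent_mul_of_isHomogeneous _ (isHomogeneous_linPoly a)]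
  split_ifs
  · exact dvd_mul_left _ _
  · exact dvd_zero _

/-- A product of defining forms of the hyperplanes satisfying `P`. -/
theorem Arrangement.exists_defining_polynomial (A : Arrangement K l)
    (P : Submodule K (Fin l → K) → Prop) :
    ∃ f : CoordRing K l,
      (∀ H ∈ A.hyperplanes, P H → ∀ a : Module.Dual K (Fin l → K), LinearMap.ker a = H →
        linPoly a ∣ f) ∧
      f ≠ 0 ∧
      ∀ p : Fin l → K, (∀ H ∈ A.hyperplanes, P H → p ∉ H) → eval p f ≠ 0 := by
  classical
  have hex (H : Submodule K (Fin l → K)) : ∃ a : Module.Dual K (Fin l → K),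
      H ∈ A.hyperplanes → a ≠ 0 ∧ LinearMap.ker a = H := by
    by_cases hH : H ∈ A.hyperplanes
    · obtain ⟨a, ha⟩ := A.isHyperplane H hH
      exact ⟨a, fun _ => ha⟩
    · exact ⟨0, fun h => absurd h hH⟩
  choose α hα using hex
  have mem {H} : H ∈ {H ∈ A.finite.toFinset | P H} ↔ H ∈ A.hyperplanes ∧ P H := by simp
  refine ⟨∏ H ∈ A.finite.toFinset with P H, linPoly (α H), ?_, ?_, ?_⟩
  · intro H hH hP a ha
    refine (linPoly_dvd_of_ker_le ?_).trans (Finset.dvd_prod_of_mem _ (mem.2 ⟨hH, hP⟩))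
    rw [ha, (hα H hH).2]
  · exact Finset.prod_ne_zero_iff.2 fun H hH => linPoly_ne_zero (hα H (mem.1 hH).1).1
  · intro p hp
    rw [map_prod]
    refine Finset.prod_ne_zero_iff.2 fun H hH => ?_
    rw [eval_linPoly]
    intro h0
    refine hp H (mem.1 hH).1 (mem.1 hH).2 ?_
    rw [← (hα H (mem.1 hH).1).2]
    exact h0

/-- The product of all defining forms works. This gives `D(A)` full rank in `Der`. -/
theorem Arrangement.exists_smul_mem_logDer (A : Arrangement K l) :
    ∃ Q : CoordRing K l, Q ≠ 0 ∧ ∀ δ : VectorField K l, Q • δ ∈ A.logDer := by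
  obtain ⟨Q, hQ, hQ0, -⟩ := A.exists_defining_polynomial fun _ => True
  refine ⟨Q, hQ0, fun δ => Arrangement.mem_logDer.2 fun H hH a ha => ?_⟩
  rw [Derivation.smul_apply, smul_eq_mul]
  exact (hQ H hH trivial a ha).mul_right _

/-- The substitution `x ↦ x + p`. -/
noncomputable def translate (p : Fin l → K) : CoordRing K l →ₐ[K] CoordRing K l :=
  aeval fun j => X j + C (p j)

theorem translate_translate_neg (p : Fin l → K) (q : CoordRing K l) :
    translate p (translate (-p) q) = q := by
  have : (translate p).comp (translate (-p)) = AlgHom.id K (CoordRing K l) :=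
    algHom_ext fun j => by
      simp [translate, algebraMap_eq]
  exact DFunLike.congr_fun this q

theorem constantCoeff_translate (p : Fin l → K) (q : CoordRing K l) :
    constantCoeff (translate p q) = eval p q := by
  induction q using MvPolynomial.induction_on with
  | C a => simp [translate, algebraMap_eq]
  | add f g hf hg => simp [hf, hg]
  | mul_X f j hf => rw [map_mul, map_mul, hf, map_mul]; simp [translate]

theorem translate_linPoly {p : Fin l → K} {a : Module.Dual K (Fin l → K)} (h : a p = 0) :
    translate p (linPoly a) = linPoly a := by
  have : translate p (linPoly a) = linPoly a + C (eval p (linPoly a)) := by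
    simp [linPoly, translate, map_sum, algebraMap_eq, mul_add, Finset.sum_add_distrib]
  rw [this, eval_linPoly, h, C_0, add_zero]

/-- Translation of vector fields. -/
noncomputable def translateVF (p : Fin l → K) : VectorField K l →ₗ[K] VectorField K l :=
  mapVF (translate p).toLinearMap

theorem translateVF_smul (p : Fin l → K) (f : CoordRing K l) (δ : VectorField K l) :
    translateVF p (f • δ) = translate p f • translateVF p δ :=
  derivation_ext fun j => by simp [translateVF]

theorem translateVF_translateVF_neg (p : Fin l → K) (δ : VectorField K l) :
    translateVF p (translateVF (-p) δ) = δ :=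
  derivation_ext fun j => by simp [translateVF, translate_translate_neg]

theorem Arrangement.translateVF_mem_logDer {A : Arrangement K l} {p : Fin l → K}
    (hp : ∀ H ∈ A.hyperplanes, p ∈ H) {δ : VectorField K l} (hδ : δ ∈ A.logDer) :
    translateVF p δ ∈ A.logDer := by
  rw [Arrangement.mem_logDer] at hδ ⊢
  intro H hH a ha
  have hap : a p = 0 := by
    rw [← LinearMap.mem_ker, ha]
    exact hp H hH
  have := map_dvd (translate p) (hδ H hH a ha)
  rw [translate_linPoly hap] at this
  rwa [translateVF, mapVF_linPoly]

theorem Arrangement.exists_generic_point [Infinite K] (A : Arrangement K l)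
    (X : Submodule K (Fin l → K)) : ∃ p ∈ X, ∀ H ∈ A.hyperplanes, ¬ X ≤ H → p ∉ H := by
  classical
  let s : Finset (Submodule K X) :=
    -- The traces on `X` of the hyperplanes not containing it: finitely many proper subspaces, which
    -- cannot cover `X` over an infinite field.
    {H ∈ A.finite.toFinset | ¬ X ≤ H}.image fun H => H.comap X.subtype
  have hs : ⊤ ∉ s := by
    intro h
    obtain ⟨H, hH, he⟩ := Finset.mem_image.1 h
    refine (Finset.mem_filter.1 hH).2 fun x hx => ?_
    have : (⟨x, hx⟩ : X) ∈ H.comap X.subtype := he ▸ Submodule.mem_top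
    exact this
  obtain ⟨p, hp⟩ := (Set.ne_univ_iff_exists_notMem _).1 (Subspace.biUnion_ne_univ_of_top_notMem hs)
  refine ⟨p, p.2, fun H hH hX hpH => hp ?_⟩
  refine Set.mem_biUnion (x := H.comap X.subtype) (Finset.mem_image_of_mem _ ?_) hpH
  simpa using ⟨hH, hX⟩

/-- Up to a factor not vanishing at the origin, `D(A_X)` is generated by the translates of
generators of `D(A)` to a generic point of `X`. -/
theorem Arrangement.exists_localization_generators [Infinite K] (A : Arrangement K l)
    (X : Submodule K (Fin l → K)) {ι : Type*} {θ : ι → VectorField K l}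
    (hθ : Submodule.span (CoordRing K l) (Set.range θ) = A.logDer) :
    ∃ (g : CoordRing K l) (θ' : ι → VectorField K l), constantCoeff g ≠ 0 ∧
      (∀ i, θ' i ∈ (A.localization X).logDer) ∧
      ∀ δ ∈ (A.localization X).logDer,
        g • δ ∈ Submodule.span (CoordRing K l) (Set.range θ') := by
  obtain ⟨p, hpX, hp⟩ := A.exists_generic_point X
  obtain ⟨f, hf, -, hfp⟩ := A.exists_defining_polynomial fun H => ¬ X ≤ H
  have hpH : ∀ H ∈ (A.localization X).hyperplanes, p ∈ H := fun H hH => hH.2 hpX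
  have hle : A.logDer ≤ (A.localization X).logDer := fun δ hδ H hH => hδ H hH.1
  refine ⟨translate p f, fun i => translateVF p (θ i), ?_, fun i => ?_, fun δ hδ => ?_⟩
  · rw [constantCoeff_translate]
    exact hfp p hp
  · exact translateVF_mem_logDer hpH (hle (hθ ▸ Submodule.subset_span ⟨i, rfl⟩))
  · have hδ' : translateVF (-p) δ ∈ (A.localization X).logDer :=
      translateVF_mem_logDer (fun H hH => neg_mem (hpH H hH)) hδ
    -- Hyperplanes through `X` are handled by `δ`, all others by the factor `f`. Translating back by
    -- `p` turns `f` into `translate p f`, with constant term `f(p) ≠ 0`.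
    have hmem : f • translateVF (-p) δ ∈ Submodule.span (CoordRing K l) (Set.range θ) := by
      rw [hθ, Arrangement.mem_logDer]
      intro H hH a ha
      rw [Derivation.smul_apply, smul_eq_mul]
      by_cases hXH : X ≤ H
      · exact (Arrangement.mem_logDer.1 hδ' H ⟨hH, hXH⟩ a ha).mul_left _
      · exact (hf H hH hXH a ha).mul_right _
    have himage : ∀ η ∈ Submodule.span (CoordRing K l) (Set.range θ), translateVF p η ∈
        Submodule.span (CoordRing K l) (Set.range fun i => translateVF p (θ i)) := by
      intro η hη
      induction hη using Submodule.span_induction with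
      | mem x hx =>
        obtain ⟨i, rfl⟩ := hx
        exact Submodule.subset_span ⟨i, rfl⟩
      | zero => simp
      | add x y _ _ hx hy => rw [map_add]; exact add_mem hx hy
      | smul a x _ hx => rw [translateVF_smul]; exact Submodule.smul_mem _ _ hx
    have := himage _ hmem
    rwa [translateVF_smul, translateVF_translateVF_neg] at this

end Logarithmic

/-! ### Minimal generators of graded submodules of `Der` -/

section MinimalGenerators

variable {K : Type*} [Field K] {l : ℕ}

theorem smul_sub_constantCoeff_smul_mem {M : Submodule (CoordRing K l) (VectorField K l)}
    {δ : VectorField K l} (hδ : δ ∈ M) (a : CoordRing K l) :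
    a • δ - constantCoeff a • δ ∈ irrelevantIdeal K l • M := by
  have h : a • δ - constantCoeff a • δ = (a - C (constantCoeff a)) • δ :=
    derivation_ext fun j => by simp [sub_mul, smul_eq_C_mul]
  rw [h]
  exact Submodule.smul_mem_smul (by simp [irrelevantIdeal, RingHom.mem_ker]) hδ

/-- A graded submodule of `Der` which is generated by `n` elements up to a factor not vanishing at
the origin has at most `n` homogeneous generators, with relations in the irrelevant ideal. -/
theorem exists_minimal_generators {M : Submodule (CoordRing K l) (VectorField K l)}
    (hM : IsGradedSubmodule M) {n : ℕ} {g : CoordRing K l} (hg : constantCoeff g ≠ 0)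
    {θ : Fin n → VectorField K l} (hθ : ∀ i, θ i ∈ M)
    (hgθ : ∀ δ ∈ M, g • δ ∈ Submodule.span (CoordRing K l) (Set.range θ)) :
    ∃ k ≤ n, ∃ (e : Fin k → ℕ) (η : Fin k → VectorField K l),
      (∀ i, IsHomogeneousVF (η i) (e i)) ∧
      Submodule.span (CoordRing K l) (Set.range η) = M ∧
      ∀ v : Fin k → CoordRing K l, ∑ i, v i • η i = 0 → ∀ i, constantCoeff (v i) = 0 := by
  classical
  -- The quotient is taken of all of `Der`; the image of `M` in it is `M/𝔪M`, on which a polynomial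
  -- acts through its constant term (`hπ`).
  let π := (irrelevantIdeal K l • M).mkQ
  let πK : VectorField K l →ₗ[K] _ := π.restrictScalars K
  have hπ {δ : VectorField K l} (hδ : δ ∈ M) (a : CoordRing K l) :
      πK (a • δ) = constantCoeff a • πK δ := by
    rw [← map_smul, ← sub_eq_zero, ← map_sub]
    exact (Submodule.Quotient.mk_eq_zero _).2 (smul_sub_constantCoeff_smul_mem hδ a)
  have hspan {δ : VectorField K l} (hδ : δ ∈ M) :
      πK δ ∈ Submodule.span K (Set.range fun i => πK (θ i)) := by
    obtain ⟨a, ha⟩ := (Submodule.mem_span_range_iff_exists_fun _).1 (hgθ δ hδ)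
    have h : constantCoeff g • πK δ = ∑ i, constantCoeff (a i) • πK (θ i) := by
      rw [← hπ hδ, ← ha, map_sum]
      exact Finset.sum_congr rfl fun i _ => hπ (hθ i) _
    rw [← Submodule.smul_mem_iff _ hg, h]
    exact sum_mem fun i _ => Submodule.smul_mem _ _ (Submodule.subset_span ⟨i, rfl⟩)
  -- A `K`-basis of `M/𝔪M` chosen among classes of homogeneous elements. By `hspan`, where `g` acts
  -- as a nonzero scalar, it has at most `n` elements.
  obtain ⟨b, hbs, hb, hbi⟩ := exists_linearIndependent K
    (πK '' {δ | δ ∈ M ∧ ∃ d, IsHomogeneousVF δ d})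
  have hble : Set.range ((↑) : b → VectorField K l ⧸ irrelevantIdeal K l • M) ≤
      Submodule.span K (Set.range fun i => πK (θ i)) := by
    rw [Subtype.range_coe]
    intro x hx
    obtain ⟨δ, hδ, rfl⟩ := hbs hx
    exact hspan hδ.1
  have : Finite b := hbi.finite_of_le_span_finite _ _ hble
  have : Fintype b := Fintype.ofFinite b
  have hcard : Fintype.card b ≤ n := by
    refine (linearIndependent_le_span_aux' _ hbi _ hble).trans ?_
    simpa using Fintype.card_range_le (fun i => πK (θ i))
  have hex (i : Fin (Fintype.card b)) : ∃ δ ∈ M, (∃ d, IsHomogeneousVF δ d) ∧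
      πK δ = (Fintype.equivFin b).symm i := by
    obtain ⟨δ, hδ, h⟩ := hbs ((Fintype.equivFin b).symm i).2
    exact ⟨δ, hδ.1, hδ.2, h⟩
  choose η hηM hη hπη using hex
  choose e he using hη
  have hrange : Set.range (fun i => πK (η i)) = b := by
    simp_rw [hπη]
    exact ((Fintype.equivFin b).symm.surjective.range_comp Subtype.val).trans Subtype.range_coe
  have hli : LinearIndependent K fun i => πK (η i) := by
    simp_rw [hπη]
    exact hbi.comp _ (Fintype.equivFin b).symm.injective
  refine ⟨Fintype.card b, hcard, e, η, he, le_antisymm ?_ ?_, fun v hv => ?_⟩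
  · rw [Submodule.span_le]
    rintro _ ⟨i, rfl⟩
    exact hηM i
  · refine le_of_le_sup_irrelevantIdeal_smul (isGradedSubmodule_span he) fun δ hδ => ?_
    obtain ⟨N, hN⟩ := exists_sum_componentVF δ
    rw [← hN]
    refine sum_mem fun d _ => ?_
    have h : πK (componentVF d δ) ∈ Submodule.span K (Set.range fun i => πK (η i)) := by
      rw [hrange, hb]
      exact Submodule.subset_span ⟨_, ⟨hM δ hδ d, d, isHomogeneousVF_componentVF d δ⟩, rfl⟩
    obtain ⟨c, hc⟩ := (Submodule.mem_span_range_iff_exists_fun _).1 h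
    have hmem : componentVF d δ - ∑ i, c i • η i ∈ irrelevantIdeal K l • M := by
      refine (Submodule.Quotient.mk_eq_zero _).1 ?_
      change πK _ = 0
      rw [map_sub, map_sum, ← hc, sub_eq_zero]
      simp_rw [map_smul]
    rw [← add_sub_cancel (∑ i, c i • η i) (componentVF d δ)]
    refine Submodule.add_mem_sup (sum_mem fun i _ => ?_) hmem
    exact Submodule.smul_of_tower_mem _ _ (Submodule.subset_span ⟨i, rfl⟩)
  -- Modulo `𝔪M` a relation becomes a `K`-linear relation among basis vectors, with the constant
  -- terms as coefficients.
  · refine Fintype.linearIndependent_iff.1 hli (fun i => constantCoeff (v i)) ?_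
    rw [← map_zero πK, ← hv, map_sum]
    exact Finset.sum_congr rfl fun i _ => (hπ (hηM i) _).symm

/-- The coordinates of a vector field with respect to the partial derivatives. -/
noncomputable def coordVF (K : Type*) [Field K] (l : ℕ) :
    VectorField K l ≃ₗ[CoordRing K l] (Fin l → CoordRing K l) where
  toFun δ j := δ (X j)
  invFun f := mkDerivation K f
  map_add' _ _ := rfl
  map_smul' _ _ := rfl
  left_inv _ := derivation_ext fun j => by simp
  right_inv _ := funext fun j => by simp

instance : Module.Finite (CoordRing K l) (VectorField K l) :=
  Module.Finite.equiv (coordVF K l).symm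

instance : Module.IsTorsionFree (CoordRing K l) (VectorField K l) :=
  (coordVF K l).injective.moduleIsTorsionFree _ (map_smul (coordVF K l))

theorem finrank_vectorField : Module.finrank (CoordRing K l) (VectorField K l) = l := by
  rw [(coordVF K l).finrank_eq, Module.finrank_fin_fun]

/-- `D(A)` lies between `Q • Der` and `Der`, both of rank `l`. -/
theorem Arrangement.finrank_logDer (A : Arrangement K l) :
    Module.finrank (CoordRing K l) A.logDer = l := by
  obtain ⟨Q, hQ0, hQ⟩ := A.exists_smul_mem_logDer
  refine le_antisymm ((Submodule.finrank_le _).trans_eq finrank_vectorField) ?_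
  let f : VectorField K l →ₗ[CoordRing K l] A.logDer :=
    (LinearMap.lsmul _ _ Q).codRestrict _ hQ
  have hf : Function.Injective f := fun x y h => smul_right_injective _ hQ0 (congrArg Subtype.val h)
  exact finrank_vectorField.symm.trans_le (LinearMap.finrank_le_finrank_of_injective hf)

theorem finrank_add_finrank_ker_of_surjective {R M N : Type*} [CommRing R] [IsDomain R]
    [AddCommGroup M] [Module R M] [AddCommMonoid N] [Module R N] [Module.Finite R M]
    {f : M →ₗ[R] N} (hf : Function.Surjective f) :
    Module.finrank R N + Module.finrank R (LinearMap.ker f) = Module.finrank R M := by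
  let _ : AddCommGroup N := Module.addCommMonoidToAddCommGroup R
  rw [← (f.quotKerEquivOfSurjective hf).finrank_eq, Submodule.finrank_quotient_add_finrank]

/-- The relation module has rank zero by additivity of rank, and a rank-zero submodule of a free
module over a domain vanishes. -/
theorem linearIndependent_of_top_le_span_of_le_finrank {R N : Type*} [CommRing R] [IsDomain R]
    [IsNoetherianRing R] [AddCommMonoid N] [Module R N] {k : ℕ} {v : Fin k → N}
    (hv : ⊤ ≤ Submodule.span R (Set.range v)) (hk : k ≤ Module.finrank R N) :
    k = Module.finrank R N ∧ LinearIndependent R v := by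
  let _ : AddCommGroup N := Module.addCommMonoidToAddCommGroup R
  have hsurj : Function.Surjective (Fintype.linearCombination R v) := by
    rw [← LinearMap.range_eq_top, Fintype.range_linearCombination]
    exact top_le_iff.1 hv
  have h := finrank_add_finrank_ker_of_surjective hsurj
  rw [Module.finrank_fin_fun] at h
  have hker : LinearMap.ker (Fintype.linearCombination R v) = ⊥ :=
    Submodule.finrank_eq_zero.1 (by omega)
  refine ⟨by omega, Fintype.linearIndependent_iff.2 fun w hw => ?_⟩
  have h : w ∈ LinearMap.ker (Fintype.linearCombination R v) := hw
  rw [hker, Submodule.mem_bot] at h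
  exact congrFun h

/-- A saturated submodule of rank one of a free module over a factorial ring is free. -/
theorem exists_eq_span_singleton_of_finrank_eq_one {R ι : Type*} [CommRing R] [IsDomain R]
    [IsNoetherianRing R]
    [UniqueFactorizationMonoid R] [Fintype ι] (N : Submodule R (ι → R))
    (hsat : ∀ (a : R) (v : ι → R), a ≠ 0 → a • v ∈ N → v ∈ N) (hN : Module.finrank R N = 1) :
    ∃ v, v ≠ 0 ∧ N = Submodule.span R {v} := by
  classical
  let _ := UniqueFactorizationMonoid.strongNormalizationMonoid (α := R)
  let _ := UniqueFactorizationMonoid.toNormalizedGCDMonoid R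
  have hbot : N ≠ ⊥ := by
    rintro rfl
    simp at hN
  obtain ⟨v, hv, hv0⟩ := N.ne_bot_iff.1 hbot
  obtain ⟨j, hj⟩ := Function.ne_iff.1 hv0
  -- Dividing a nonzero element by the gcd of its entries gives a primitive vector, which stays in
  -- `N` by saturation and will generate it.
  obtain ⟨w, hw, hgcd⟩ := Finset.univ.extract_gcd v ⟨j, Finset.mem_univ j⟩
  have hvw : v = Finset.univ.gcd v • w := funext fun i => hw i (Finset.mem_univ i)
  have hw0 : w ≠ 0 := by
    rintro rfl
    exact hv0 (by rw [hvw, smul_zero])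
  have hg0 : Finset.univ.gcd v ≠ 0 := fun h => hv0 (by rw [hvw, h, zero_smul])
  have hwN : w ∈ N := hsat _ _ hg0 (hvw ▸ hv)
  refine ⟨w, hw0, le_antisymm (fun u hu => ?_) ?_⟩
  · have hdep : ¬ LinearIndependent R ![(⟨u, hu⟩ : N), ⟨w, hwN⟩] := by
      intro h
      have := h.fintype_card_le_finrank
      rw [hN] at this
      simp at this
    rw [LinearIndependent.pair_iff] at hdep
    push Not at hdep
    obtain ⟨a, b, hab, hne⟩ := hdep
    replace hab : a • u + b • w = 0 := congrArg Subtype.val hab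
    have ha : a ≠ 0 := by
      intro ha
      rw [ha, zero_smul, zero_add] at hab
      exact hne ha ((smul_eq_zero.1 hab).resolve_right hw0)
    -- `a` divides every `b * w i`, hence their gcd, which is `b` up to a unit as `w` is primitive.
    have hdvd : a ∣ b := by
      have h : a ∣ Finset.univ.gcd fun i => b * w i := by
        refine Finset.dvd_gcd fun i _ => ⟨-u i, ?_⟩
        have := congrFun hab i
        simp only [Pi.add_apply, Pi.smul_apply, smul_eq_mul, Pi.zero_apply] at this
        linear_combination this
      have h' := h.trans (Finset.gcd_mul_left' _ _ b).dvd
      rwa [hgcd, mul_one] at h'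
    obtain ⟨c, rfl⟩ := hdvd
    rw [mul_smul, ← smul_add] at hab
    have := (smul_eq_zero.1 hab).resolve_left ha
    refine Submodule.mem_span_singleton.2 ⟨-c, ?_⟩
    rw [neg_smul]
    exact (eq_neg_of_add_eq_zero_left this).symm
  · rw [Submodule.span_singleton_le_iff_mem]
    exact hwN

/-- The component of degree `n` of an element of `⨁ᵢ S(-eᵢ)`. -/
noncomputable def shiftedComponent {ι : Type*} (e : ι → ℕ) (n : ℕ) (v : ι → CoordRing K l) :
    ι → CoordRing K l :=
  fun i => if e i ≤ n then homogeneousComponent (n - e i) (v i) else 0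

theorem isHomogeneousShifted_shiftedComponent {ι : Type*} (e : ι → ℕ) (n : ℕ)
    (v : ι → CoordRing K l) : IsHomogeneousShifted e n (shiftedComponent e n v) := by
  intro i
  unfold shiftedComponent
  split_ifs with h
  · exact Or.inr ⟨n - e i, Nat.sub_add_cancel h, homogeneousComponent_isHomogeneous _ _⟩
  · exact Or.inl rfl

theorem componentVF_sum_smul {ι : Type*} [Fintype ι] {e : ι → ℕ} {η : ι → VectorField K l}
    (h : ∀ i, IsHomogeneousVF (η i) (e i)) (n : ℕ) (v : ι → CoordRing K l) :
    componentVF n (∑ i, v i • η i) = ∑ i, shiftedComponent e n v i • η i := by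
  rw [map_sum]
  refine Finset.sum_congr rfl fun i _ => ?_
  rw [componentVF_smul (h i), shiftedComponent]
  split_ifs <;> simp

/-- A free graded submodule of rank one has a homogeneous generator. -/
theorem exists_isHomogeneousShifted_generator {ι : Type*} {e : ι → ℕ}
    {v : ι → CoordRing K l} (hv : v ≠ 0)
    (hgr : ∀ n, shiftedComponent e n v ∈ Submodule.span (CoordRing K l) {v}) :
    ∃ n w, IsHomogeneousShifted e n w ∧ w ≠ 0 ∧
      Submodule.span (CoordRing K l) {w} = Submodule.span (CoordRing K l) {v} := by
  obtain ⟨i, hi⟩ := Function.ne_iff.1 hv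
  have hm : ∃ m, homogeneousComponent m (v i) ≠ 0 := by
    by_contra! h
    exact hi (by rw [← sum_homogeneousComponent (v i)]; simp [h])
  obtain ⟨m, hm⟩ := hm
  have hcomp : shiftedComponent e (m + e i) v i = homogeneousComponent m (v i) := by
    simp [shiftedComponent]
  obtain ⟨a, ha⟩ := Submodule.mem_span_singleton.1 (hgr (m + e i))
  have hai : a * v i = homogeneousComponent m (v i) := by
    rw [← hcomp, ← ha, Pi.smul_apply, smul_eq_mul]
  have ha0 : a ≠ 0 := by
    rintro rfl
    exact hm (by rw [← hai, zero_mul])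
  -- The component equals `a * v i` and its degree does not exceed that of `v i`, so `a` is a
  -- nonzero constant. Hence the shifted component of `v` is a unit multiple of `v`.
  have hle : (homogeneousComponent m (v i)).totalDegree ≤ (v i).totalDegree := by
    rw [(homogeneousComponent_isHomogeneous m (v i)).totalDegree hm]
    by_contra! hlt
    exact hm (homogeneousComponent_eq_zero _ _ hlt)
  rw [← hai, totalDegree_mul_of_isDomain ha0 hi] at hle
  have haC := totalDegree_eq_zero_iff_eq_C.1 (show a.totalDegree = 0 by omega)
  have hunit : IsUnit a := by
    rw [haC]
    refine (IsUnit.mk0 _ fun h => ha0 ?_).map C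
    rw [haC, h, C_0]
  refine ⟨m + e i, shiftedComponent e (m + e i) v, isHomogeneousShifted_shiftedComponent _ _ _,
    ?_, ?_⟩
  · intro h
    exact hm (by rw [← hcomp, h, Pi.zero_apply])
  · rw [← ha]
    exact Submodule.span_singleton_smul_eq hunit v

theorem isHomogeneousVF_sum_smul {ι : Type*} [Fintype ι] {e : ι → ℕ} {η : ι → VectorField K l}
    (h : ∀ i, IsHomogeneousVF (η i) (e i)) {n : ℕ} {v : ι → CoordRing K l}
    (hv : IsHomogeneousShifted e n v) : IsHomogeneousVF (∑ i, v i • η i) n := by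
  refine IsHomogeneousVF.sum fun i _ => ?_
  rcases hv i with h0 | ⟨k, rfl, hk⟩
  · rw [h0, zero_smul]
    exact fun j => by simpa using isHomogeneous_zero _ _ _
  · exact (h i).smul hk

/-- A submodule of `Der` minimally generated by one more homogeneous element than its rank has a
minimal graded free resolution of length one with a single relation. -/
theorem exists_isMinimalResolution {M : Submodule (CoordRing K l) (VectorField K l)} {r : ℕ}
    (hr : Module.finrank (CoordRing K l) M = r) {e : Fin (r + 1) → ℕ}
    {η : Fin (r + 1) → VectorField K l} (hη : ∀ i, IsHomogeneousVF (η i) (e i))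
    (hspan : Submodule.span (CoordRing K l) (Set.range η) = M)
    (hmin : ∀ v : Fin (r + 1) → CoordRing K l, ∑ i, v i • η i = 0 →
      ∀ i, constantCoeff (v i) = 0) :
    ∃ (c : ℕ) (φ : (Fin 1 → CoordRing K l) →ₗ[CoordRing K l] (Fin (r + 1) → CoordRing K l))
      (ε : (Fin (r + 1) → CoordRing K l) →ₗ[CoordRing K l] M),
      IsMinimalResolution M (fun _ => c) e φ ε := by
  have hmem (v : Fin (r + 1) → CoordRing K l) :
      Fintype.linearCombination (CoordRing K l) η v ∈ M := by
    rw [← hspan, ← Fintype.range_linearCombination]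
    exact ⟨v, rfl⟩
  let ε := (Fintype.linearCombination (CoordRing K l) η).codRestrict M hmem
  have hε (v : Fin (r + 1) → CoordRing K l) :
      (ε v : VectorField K l) = ∑ i, v i • η i := rfl
  have hsurj : Function.Surjective ε := by
    rintro ⟨δ, hδ⟩
    rw [← hspan, ← Fintype.range_linearCombination] at hδ
    obtain ⟨v, hv⟩ := hδ
    exact ⟨v, Subtype.ext hv⟩
  have hker {v : Fin (r + 1) → CoordRing K l} : v ∈ LinearMap.ker ε ↔ ∑ i, v i • η i = 0 := by
    rw [LinearMap.mem_ker, ← hε, ZeroMemClass.coe_eq_zero]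
  have hrank : Module.finrank (CoordRing K l) (LinearMap.ker ε) = 1 := by
    have h := finrank_add_finrank_ker_of_surjective hsurj
    rw [hr, Module.finrank_fin_fun] at h
    omega
  obtain ⟨v, hv0, hv⟩ := exists_eq_span_singleton_of_finrank_eq_one (LinearMap.ker ε)
    (fun a v ha h => by
      rw [LinearMap.mem_ker, map_smul] at h
      exact (smul_eq_zero.1 h).resolve_left ha) hrank
  have hgr (n : ℕ) : shiftedComponent e n v ∈ Submodule.span (CoordRing K l) {v} := by
    have h : v ∈ LinearMap.ker ε := hv ▸ Submodule.mem_span_singleton_self v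
    rw [← hv, hker, ← componentVF_sum_smul hη, hker.1 h, map_zero]
  obtain ⟨c, w, hw, hw0, hwv⟩ := exists_isHomogeneousShifted_generator hv0 hgr
  rw [← hwv] at hv
  have hφ (u : Fin 1 → CoordRing K l) :
      ((LinearMap.toSpanSingleton (CoordRing K l) _ w).comp (LinearMap.proj 0)) u = u 0 • w := rfl
  refine ⟨c, (LinearMap.toSpanSingleton (CoordRing K l) _ w).comp (LinearMap.proj 0), ε, ?_⟩
  have hw_mem (a : CoordRing K l) : a • w ∈ LinearMap.ker ε :=
    hv ▸ Submodule.smul_mem _ _ (Submodule.mem_span_singleton_self w)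
  refine ⟨fun n u hu i => ?_, fun n v hv => ?_, fun u u' h => ?_, fun x => ?_, hsurj,
    fun u i => ?_⟩
  · rw [hφ, Pi.smul_apply, smul_eq_mul]
    rcases hu 0 with h0 | ⟨k, rfl, hk⟩
    · exact Or.inl (by rw [h0, zero_mul])
    · rcases hw i with h0 | ⟨k', rfl, hk'⟩
      · exact Or.inl (by rw [h0, mul_zero])
      · exact Or.inr ⟨k + k', add_assoc _ _ _, hk.mul hk'⟩
  · rw [hε]
    exact isHomogeneousVF_sum_smul hη hv
  · rw [hφ, hφ] at h
    funext i
    rw [Subsingleton.elim i 0]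
    exact smul_left_injective _ hw0 h
  · rw [← LinearMap.mem_ker, hv, Submodule.mem_span_singleton]
    constructor
    · rintro ⟨a, rfl⟩
      exact ⟨fun _ => a, rfl⟩
    · rintro ⟨u, rfl⟩
      exact ⟨u 0, rfl⟩
  · exact hmin _ (hker.1 (hw_mem (u 0))) i

/-- At most `l` homogeneous generators of `D(A)` form a basis. -/
theorem Arrangement.isFree_of_generators (A : Arrangement K l) {k : ℕ} (hk : k ≤ l)
    {e : Fin k → ℕ} {η : Fin k → VectorField K l} (hη : ∀ i, IsHomogeneousVF (η i) (e i))
    (hspan : Submodule.span (CoordRing K l) (Set.range η) = A.logDer) : A.IsFree := by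
  have hmem (i : Fin k) : η i ∈ A.logDer := hspan ▸ Submodule.subset_span ⟨i, rfl⟩
  let η' : Fin k → A.logDer := fun i => ⟨η i, hmem i⟩
  have htop : ⊤ ≤ Submodule.span (CoordRing K l) (Set.range η') := by
    rintro ⟨δ, hδ⟩ -
    rw [← hspan] at hδ
    obtain ⟨v, hv⟩ := (Submodule.mem_span_range_iff_exists_fun _).1 hδ
    refine (Submodule.mem_span_range_iff_exists_fun _).2 ⟨v, Subtype.ext ?_⟩
    rw [AddSubmonoidClass.coe_finsetSum]
    exact hv
  obtain ⟨hkl, hli⟩ := linearIndependent_of_top_le_span_of_le_finrank htop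
    (hk.trans_eq A.finrank_logDer.symm)
  obtain rfl : k = l := hkl.trans A.finrank_logDer
  refine ⟨e, Module.Basis.mk hli htop, fun i => ?_⟩
  rw [Module.Basis.mk_apply]
  exact hη i

end MinimalGenerators

end HypArr

/-! ### Localizations of plus-one generated arrangements -/

open HypArr in
theorem corollary5p4 {K : Type*} [Field K] [CharZero K] {l : ℕ} (A : HypArr.Arrangement K l)
    (hA : A.IsPlusOneGenerated) (X : Submodule K (Fin l → K)) (hX : X ∈ A.lattice) :
    ((A.localization X).IsFree ∨
      ∃ (c : ℕ) (e : Fin (l + 1) → ℕ)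
        (φ : (Fin 1 → HypArr.CoordRing K l) →ₗ[HypArr.CoordRing K l]
          (Fin (l + 1) → HypArr.CoordRing K l))
        (ε : (Fin (l + 1) → HypArr.CoordRing K l) →ₗ[HypArr.CoordRing K l]
          (A.localization X).logDer),
        HypArr.IsMinimalResolution (A.localization X).logDer (fun _ => c) e φ ε) ∧
    ∃ θ : Fin (l + 1) → HypArr.VectorField K l,
      Submodule.span (HypArr.CoordRing K l) (Set.range θ) = (A.localization X).logDer := by
  obtain ⟨d, d₀, φ, ε, hres⟩ := hA
  classical
  -- Only the surjectivity of `ε` is needed: the images of the standard basis are `l + 1` generators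
  -- of `D(A)`.
  have hθ : Submodule.span (CoordRing K l)
      (Set.range fun i => (ε (Pi.single i 1) : VectorField K l)) = A.logDer := by
    have h := Fintype.range_linearCombination (CoordRing K l)
      (fun i => (ε (Pi.single i 1) : VectorField K l))
    rw [← h]
    have hε : Fintype.linearCombination (CoordRing K l)
        (fun i => (ε (Pi.single i 1) : VectorField K l)) = A.logDer.subtype.comp ε := by
      refine LinearMap.pi_ext' fun i => LinearMap.ext_ring ?_
      simp [Fintype.linearCombination_apply_single]
    rw [hε, LinearMap.range_comp, LinearMap.range_eq_top.2 hres.surjective, Submodule.map_top,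
      Submodule.range_subtype]
  obtain ⟨g, θ, hg, hθM, hgθ⟩ := A.exists_localization_generators X hθ
  obtain ⟨k, hk, e, η, hη, hspan, hmin⟩ := exists_minimal_generators
    (A.localization X).isGradedSubmodule_logDer hg hθM hgθ
  constructor
  · rcases hk.lt_or_eq with hlt | rfl
    · exact Or.inl ((A.localization X).isFree_of_generators (Nat.le_of_lt_succ hlt) hη hspan)
    · obtain ⟨c, φ, ε, h⟩ := exists_isMinimalResolution (A.localization X).finrank_logDer hη
        hspan hmin
      exact Or.inr ⟨c, e, φ, ε, h⟩
  -- The `k ≤ l + 1` minimal generators are padded with zeros.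
  · refine ⟨fun i => if h : (i : ℕ) < k then η ⟨i, h⟩ else 0, ?_⟩
    rw [← hspan]
    refine le_antisymm (Submodule.span_le.2 ?_) (Submodule.span_mono ?_)
    · rintro _ ⟨i, rfl⟩
      dsimp only
      split_ifs with h
      · exact Submodule.subset_span ⟨_, rfl⟩
      · exact zero_mem _
    · rintro _ ⟨i, rfl⟩
      exact ⟨⟨i, i.2.trans_le hk⟩, by simp⟩
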